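/- Let $\mathbb S^2\subset\mathbb R^3$ be the unit sphere, $\sigma$ its area measure and $\mu=\sigma/(4\pi)$. For non-antipodal $x,y\in\mathbb S^2$ let $[xy]$ be the shorter geodesic segment joining them; $[x_1x_2]$ crosses $[x_3x_4]$ if the two segments meet at a point that is not an endpoint of either of them. A *spherical geodesic drawing* $\mathcal D=(G,p)$ of a simple graph $G$ is given by an injective map $p:V(G)\to\mathbb S^2$ sending no adjacent pair to antipodal points, each edge $uv$ being drawn as $[p(u)p(v)]$, such that the drawing is good: no edge contains a vertex in its relative interior, no two edges are tangent or meet at infinitely many points, and no three edges share an interior point. Let $\operatorname{cr}(\mathcal D)$ be the number of its crossings, i.e. of points that lie on two different edges and do not represent a vertex. A sequence $\mathcal D_n=(G_n,p_n)$ of spherical geodesic drawings with $|V(G_n)|=n$ is *uniform* if $\frac1n\sum_{v\in V(G_n)}F(p_n(v))\to\int_{\mathbb S^2}F\,\mathrm d\mu$ for every continuous $F:\mathbb S^2\to\mathbb R$. For $w:\mathbb S^2\times\mathbb S^2\to[0,\infty)$ put $$e(w)=\int_{\mathbb S^2}\int_{\mathbb S^2}w(x,y)\,\mu(\mathrm dx)\,\mu(\mathrm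 dy),\qquad \operatorname{Cr}(w)=\int_{(\mathbb S^2)^4}w(x_1,x_2)\,w(x_3,x_4)\,\mathbf 1_{\{[x_1x_2]\text{ crosses }[x_3x_4]\}}\prod_{i=1}^4\mu(\mathrm dx_i).$$ **Proposition.** There are absolute constants $c,C>0$ such that the following holds for every uniform sequence $\mathcal D_n=(G_n,p_n)$ of spherical geodesic drawings and every fixed $\delta\in(0,c)$. There are smooth functions $\rho_{n,\delta}:\mathbb S^2\to[0,\infty)$ and $w_{n,\delta}:\mathbb S^2\times\mathbb S^2\to[0,\infty)$ ($n\ge1$) with the following properties. (i) $\int_{\mathbb S^2}\rho_{n,\delta}\,\mathrm d\mu=1$ for every $n$, and $\|\rho_{n,\delta}-1\|_{L^\infty(\mu)}\to0$ as $n\to\infty$. (ii) For every $n$, $w_{n,\delta}$ is symmetric, $w_{n,\delta}(x,y)\le\rho_{n,\delta}(x)\rho_{n,\delta}(y)$ for all $x,y$, and $e(w_{n,\delta})=2|E(G_n)|/n^2$. (iii) For every $n$, $$\operatorname{Cr}(w_{n,\delta})\le 8\,\frac{\operatorname{cr}(\mathcal D_n)}{n^4}+C\sqrt\delta+o_\delta(1),$$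 where $o_\delta(1)\to0$ as $n\to\infty$ with the sequence and $\delta$ fixed. -/

import Mathlib

open MeasureTheory Filter Topology
open scoped Manifold ContDiff

namespace SphericalDrawing

/-- The unit sphere `S²` in Euclidean three-space. -/
abbrev S2 : Type := Metric.sphere (0 : EuclideanSpace ℝ (Fin 3)) 1

/-- The spherical area measure `σ` (total mass `4π`). -/
noncomputable def area : Measure S2 :=
  (volume : Measure (EuclideanSpace ℝ (Fin 3))).toSphere

/-- The normalized spherical area measure `μ = σ / (4π)`. -/
noncomputable def mu : Measure S2 := ENNReal.ofReal (1 / (4 * Real.pi)) • area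

theorem area_univ : area Set.univ = ENNReal.ofReal (4 * Real.pi) := by
  have h : (volume : Measure (EuclideanSpace ℝ (Fin 3))) (Metric.ball 0 1)
      = ENNReal.ofReal (Real.pi * 4 / 3) := by
    rw [EuclideanSpace.volume_ball_fin_three]
    simp
  rw [area, Measure.toSphere_apply_univ, h, finrank_euclideanSpace_fin]
  rw [show ((3 : ℕ) : ENNReal) = ENNReal.ofReal 3 by norm_num,
    ← ENNReal.ofReal_mul (by norm_num)]
  congr 1
  ring

instance : IsProbabilityMeasure mu := by
  constructor
  rw [mu, Measure.smul_apply, area_univ, smul_eq_mul,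
    ← ENNReal.ofReal_mul (by positivity)]
  rw [one_div, inv_mul_cancel₀ (by positivity), ENNReal.ofReal_one]

/-- The closed geodesic segment `[xy]`: the points of the sphere in the cone spanned by `x` and `y`.
For `y ≠ ± x` this is the shorter arc of the great circle through `x` and `y`, and `[xx] = {x}`.
(For antipodal points there is no shorter arc; the value `{x, -x}` then plays no role.) -/
def geodesicSegment (x y : S2) : Set S2 :=
  {z | ∃ a b : ℝ, 0 ≤ a ∧ 0 ≤ b ∧
    (z : EuclideanSpace ℝ (Fin 3)) = a • (x : EuclideanSpace ℝ (Fin 3)) + b • (y : EuclideanSpace ℝ (Fin 3))}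

/-- The relative interior of `[xy]`: the segment without its endpoints. -/
def geodesicInterior (x y : S2) : Set S2 := geodesicSegment x y \ {x, y}

/-- The plane through the origin that cuts out the great circle supporting `[xy]`. It determines
the tangent line of `[xy]` at each of its points. -/
def supportPlane (x y : S2) : Submodule ℝ (EuclideanSpace ℝ (Fin 3)) :=
  Submodule.span ℝ {(x : EuclideanSpace ℝ (Fin 3)), (y : EuclideanSpace ℝ (Fin 3))}

/-- `[x₁x₂]` crosses `[x₃x₄]`: they meet at a point that is an endpoint of neither. -/
def Crosses (x₁ x₂ x₃ x₄ : S2) : Prop :=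
  (geodesicInterior x₁ x₂ ∩ geodesicInterior x₃ x₄).Nonempty

/-- A spherical geodesic drawing of a simple graph `G`: a good drawing on `S²` given by the
positions of the vertices, every edge `uv` being drawn as `[p(u)p(v)]`. -/
structure GeodesicDrawing {V : Type*} (G : SimpleGraph V) where
  /-- The position `p` of the vertices. -/
  pos : V → S2
  injective : Function.Injective pos
  /-- Adjacent vertices are not antipodal. -/
  not_antipodal : ∀ u v, G.Adj u v → pos v ≠ -pos u
  /-- No edge contains a vertex in its relative interior. -/
  no_vertex : ∀ u v w, G.Adj u v → pos w ∉ geodesicInterior (pos u) (pos v)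
  /-- No two edges meet at infinitely many points. -/
  finite_inter : ∀ a b u v, G.Adj a b → G.Adj u v → s(a, b) ≠ s(u, v) →
    (geodesicSegment (pos a) (pos b) ∩ geodesicSegment (pos u) (pos v)).Finite
  /-- No two edges are tangent to each other: at a common interior point they have different
  tangent lines. -/
  not_tangent : ∀ a b u v, G.Adj a b → G.Adj u v → s(a, b) ≠ s(u, v) →
    Crosses (pos a) (pos b) (pos u) (pos v) →
    supportPlane (pos a) (pos b) ≠ supportPlane (pos u) (pos v)
  /-- No three edges share an interior point. -/
  no_triple : ∀ a b u v x y, G.Adj a b → G.Adj u v → G.Adj x y →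
    s(a, b) ≠ s(u, v) → s(a, b) ≠ s(x, y) → s(u, v) ≠ s(x, y) →
    geodesicInterior (pos a) (pos b) ∩ geodesicInterior (pos u) (pos v) ∩
      geodesicInterior (pos x) (pos y) = ∅

/-- The crossings of a drawing: the points that lie on two different edges and do not represent
a vertex. -/
def GeodesicDrawing.crossings {V : Type*} {G : SimpleGraph V} (D : GeodesicDrawing G) : Set S2 :=
  {q | q ∉ Set.range D.pos ∧ ∃ a b u v, G.Adj a b ∧ G.Adj u v ∧ s(a, b) ≠ s(u, v) ∧
    q ∈ geodesicSegment (D.pos a) (D.pos b) ∧ q ∈ geodesicSegment (D.pos u) (D.pos v)}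

/-- `cr(D)`, the number of crossings of a drawing. -/
noncomputable def GeodesicDrawing.cr {V : Type*} {G : SimpleGraph V} (D : GeodesicDrawing G) : ℕ :=
  D.crossings.ncard

/-- For a finite graph, there are finitely many crossings. -/
theorem GeodesicDrawing.finite_crossings {V : Type*} [Finite V] {G : SimpleGraph V}
    (D : GeodesicDrawing G) : D.crossings.Finite := by
  have h : (⋃ t : {t : V × V × V × V // G.Adj t.1 t.2.1 ∧ G.Adj t.2.2.1 t.2.2.2 ∧
      s(t.1, t.2.1) ≠ s(t.2.2.1, t.2.2.2)},
      geodesicSegment (D.pos t.1.1) (D.pos t.1.2.1) ∩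
        geodesicSegment (D.pos t.1.2.2.1) (D.pos t.1.2.2.2)).Finite :=
    Set.finite_iUnion fun t => D.finite_inter _ _ _ _ t.2.1 t.2.2.1 t.2.2.2
  refine h.subset ?_
  rintro q ⟨-, a, b, u, v, h1, h2, h3, h4, h5⟩
  exact Set.mem_iUnion.2 ⟨⟨(a, b, u, v), h1, h2, h3⟩, h4, h5⟩

/-- A sequence of drawings, the `n`-th one with `n` vertices, is uniform on the sphere: the
empirical measures of the vertices converge weakly to `μ`. -/
def IsUniform {V : ℕ → Type*} [∀ n, Fintype (V n)] {G : ∀ n, SimpleGraph (V n)}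
    (D : ∀ n, GeodesicDrawing (G n)) : Prop :=
  (∀ n, Fintype.card (V n) = n) ∧
  ∀ F : S2 → ℝ, Continuous F →
    Tendsto (fun n : ℕ => (1 / (n : ℝ)) * ∑ v, F ((D n).pos v)) atTop (𝓝 (∫ x, F x ∂mu))

/-- The ordered edge density `e(w)`. -/
noncomputable def edgeDensity (w : S2 → S2 → ℝ) : ℝ := ∫ x, ∫ y, w x y ∂mu ∂mu

/-- The integrand of the crossing functional. -/
noncomputable def crossingIntegrand (w : S2 → S2 → ℝ) : (Fin 4 → S2) → ℝ :=
  {x : Fin 4 → S2 | Crosses (x 0) (x 1) (x 2) (x 3)}.indicator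
    fun x => w (x 0) (x 1) * w (x 2) (x 3)

/-- The crossing functional `Cr(w)`. -/
noncomputable def Cr (w : S2 → S2 → ℝ) : ℝ :=
  ∫ x, crossingIntegrand w x ∂(Measure.pi fun _ : Fin 4 => mu)

theorem measurableSet_crosses :
    MeasurableSet {x : Fin 4 → S2 | Crosses (x 0) (x 1) (x 2) (x 3)} := by
  let A : Set ((Fin 4 → S2) × S2 × (Fin 4 → ℝ)) := {t | (∀ i, 0 ≤ t.2.2 i) ∧
    (t.2.1 : EuclideanSpace ℝ (Fin 3)) = t.2.2 0 • (t.1 0 : EuclideanSpace ℝ (Fin 3))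
      + t.2.2 1 • (t.1 1 : EuclideanSpace ℝ (Fin 3)) ∧
    (t.2.1 : EuclideanSpace ℝ (Fin 3)) = t.2.2 2 • (t.1 2 : EuclideanSpace ℝ (Fin 3))
      + t.2.2 3 • (t.1 3 : EuclideanSpace ℝ (Fin 3))}
  let B : Set ((Fin 4 → S2) × S2 × (Fin 4 → ℝ)) := {t | ∀ i, t.2.1 ≠ t.1 i}
  have hA : IsClosed A := by
    have h0 : IsClosed (⋂ i : Fin 4, {t : (Fin 4 → S2) × S2 × (Fin 4 → ℝ) | 0 ≤ t.2.2 i}) :=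
      isClosed_iInter fun i => isClosed_le (by fun_prop) (by fun_prop)
    have h1 : ∀ i j : Fin 4, IsClosed {t : (Fin 4 → S2) × S2 × (Fin 4 → ℝ) |
        (t.2.1 : EuclideanSpace ℝ (Fin 3)) = t.2.2 i • (t.1 i : EuclideanSpace ℝ (Fin 3))
          + t.2.2 j • (t.1 j : EuclideanSpace ℝ (Fin 3))} := fun i j =>
      isClosed_eq (by fun_prop) (by fun_prop)
    convert h0.inter ((h1 0 1).inter (h1 2 3)) using 1
    ext t
    simp [A]
  have hB : IsOpen B := by
    have h0 : IsOpen (⋂ i : Fin 4, {t : (Fin 4 → S2) × S2 × (Fin 4 → ℝ) | t.2.1 ≠ t.1 i}) :=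
      isOpen_iInter_of_finite fun i => isOpen_ne_fun (by fun_prop) (by fun_prop)
    convert h0 using 1
    ext t
    simp [B]
  obtain ⟨F, hF, -, hFB, -⟩ := hB.exists_iUnion_isClosed
  have key : {x : Fin 4 → S2 | Crosses (x 0) (x 1) (x 2) (x 3)}
      = ⋃ n, ⋃ m, Prod.fst '' ((A ∩ F n) ∩ compactCovering _ m) := by
    rw [← Set.iUnion_congr fun n => Set.image_iUnion (f := Prod.fst)]
    simp only [← Set.inter_iUnion, iUnion_compactCovering, Set.inter_univ]
    rw [← Set.image_iUnion, ← Set.inter_iUnion, hFB]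
    ext x
    simp only [Set.mem_ofPred_eq, Crosses, geodesicInterior, geodesicSegment, Set.mem_image]
    constructor
    · rintro ⟨q, ⟨⟨a, b, ha, hb, h1⟩, h2⟩, ⟨c, d, hc, hd, h3⟩, h4⟩
      simp only [Set.mem_insert_iff, Set.mem_singleton_iff, not_or] at h2 h4
      refine ⟨(x, q, ![a, b, c, d]), ⟨⟨?_, by simpa using h1, by simpa using h3⟩, ?_⟩, rfl⟩
      · intro i; fin_cases i <;> simpa
      · intro i; fin_cases i
        exacts [h2.1, h2.2, h4.1, h4.2]
    · rintro ⟨⟨x', q, f⟩, ⟨⟨h0, h1, h2⟩, h3⟩, rfl⟩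
      refine ⟨q, ⟨⟨_, _, h0 0, h0 1, h1⟩, ?_⟩, ⟨_, _, h0 2, h0 3, h2⟩, ?_⟩
      · simpa using ⟨h3 0, h3 1⟩
      · simpa using ⟨h3 2, h3 3⟩
  rw [key]
  refine MeasurableSet.iUnion fun n => MeasurableSet.iUnion fun m => ?_
  exact ((((isCompact_compactCovering _ m).inter_left
    (hA.inter (hF n))).image continuous_fst).isClosed).measurableSet

/-- For continuous `w` the integral defining `Cr(w)` is a genuine one. -/
theorem integrable_crossingIntegrand {w : S2 → S2 → ℝ} (hw : Continuous (Function.uncurry w)) :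
    Integrable (crossingIntegrand w) (Measure.pi fun _ : Fin 4 => mu) := by
  refine Integrable.indicator ?_ measurableSet_crosses
  have h : ∀ i j : Fin 4, Continuous fun x : Fin 4 → S2 => w (x i) (x j) := fun i j =>
    hw.comp (g := Function.uncurry w) (f := fun x : Fin 4 → S2 => (x i, x j))
      ((continuous_apply i).prodMk (continuous_apply j))
  exact ((h 0 1).mul (h 2 3)).integrable_of_hasCompactSupport
    (HasCompactSupport.of_compactSpace _)

end SphericalDrawing

namespace SphericalDrawing

open scoped Pointwise

-- Replace every vertex by a smooth rotation-invariant bump of mass 1 and radius `η`. The average of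
-- the bumps is the density; the sum of their products over ordered adjacent pairs, divided by `n ^
-- 2`, is the kernel. Mass and edge density are then exact, and the kernel is at most the product of
-- densities because it keeps only some terms of that product. Uniformity makes the density tend to
-- 1 uniformly, for fixed `η`.
--
-- The crossing bound rests on stability. Outside a null set, crossing is the open condition
-- `stableCrossing` on signs of determinants, so inner regularity gives a compact `K` of crossing
-- quadruples that misses mass at most `√δ`, and a radius `η` at which moving the points of a
-- quadruple in `K` preserves the crossing (`exists_compact_stable`). On `K`, only pairs of edges
-- that really cross contribute to the product of kernels, and each ordered pair of oriented edges
-- has total mass `1 / n ^ 4`. Off `K`, the integrand is at most about 1 on a set of mass `√δ`.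
-- Finally, `card_crossingTuples_le` bounds the number of contributing pairs by `8 cr + 2 n ^ 2`.

local notation "E3" => EuclideanSpace ℝ (Fin 3)

/-! ### Degenerate configurations are null. -/

theorem mu_submodule {P : Submodule ℝ E3} (hP : P ≠ ⊤) : mu {z : S2 | (z : E3) ∈ P} = 0 := by
  have hm : MeasurableSet {z : S2 | (z : E3) ∈ P} :=
    (P.closed_of_finiteDimensional.preimage continuous_subtype_val).measurableSet
  rw [mu, Measure.smul_apply, area, Measure.toSphere_apply' _ hm]
  have h0 : volume (Set.Ioo (0 : ℝ) 1 • (((↑) : S2 → E3) '' {z : S2 | (z : E3) ∈ P})) = 0 := by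
    refine measure_mono_null ?_ (Measure.addHaar_submodule volume P hP)
    rintro _ ⟨t, -, _, ⟨z, hz, rfl⟩, rfl⟩
    exact P.smul_mem t hz
  rw [h0, mul_zero, smul_zero]

theorem mu_singleton (x : S2) : mu {x} = 0 := by
  refine measure_mono_null (t := {z : S2 | (z : E3) ∈ Submodule.span ℝ {(x : E3)}}) ?_
    (mu_submodule ?_)
  · rintro _ rfl
    exact Submodule.mem_span_singleton_self _
  · intro h
    have h1 := finrank_span_le_card (R := ℝ) ({(x : E3)} : Set E3)
    rw [h, finrank_top, finrank_euclideanSpace_fin] at h1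
    simp at h1

/-- The determinant of three vectors. -/
def det3 (x y z : E3) : ℝ :=
  x 0 * (y 1 * z 2 - y 2 * z 1) - x 1 * (y 0 * z 2 - y 2 * z 0) + x 2 * (y 0 * z 1 - y 1 * z 0)

/-- As a function of `z` the determinant is the linear functional given by the cross product of `x`
and `y`, which is nonzero unless `y = ± x`. -/
theorem mu_det3_eq_zero {x y : S2} (h1 : y ≠ x) (h2 : y ≠ -x) :
    mu {z : S2 | det3 x y z = 0} = 0 := by
  let f : E3 →ₗ[ℝ] ℝ :=
    { toFun := fun z => det3 x y z
      map_add' := fun a b => by simp only [det3, PiLp.add_apply]; ring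
      map_smul' := fun a b => by
        simp only [det3, PiLp.smul_apply, smul_eq_mul, RingHom.id_apply]; ring }
  have hf : LinearMap.ker f ≠ ⊤ := by
    intro h
    have h3 : ∀ z, det3 x y z = 0 := fun z => by
      have : z ∈ LinearMap.ker f := h ▸ Submodule.mem_top
      simpa [f] using this
    -- The values at the basis vectors are the coordinates of the cross product.
    have e0 := h3 (EuclideanSpace.single 0 1)
    have e1 := h3 (EuclideanSpace.single 1 1)
    have e2 := h3 (EuclideanSpace.single 2 1)
    simp [det3] at e0 e1 e2
    have hx : ‖(x : E3)‖ = 1 := by simp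
    have hy : ‖(y : E3)‖ = 1 := by simp
    have hx2 : ‖(x : E3)‖ ^ 2 = 1 := by rw [hx]; norm_num
    have hy2 : ‖(y : E3)‖ ^ 2 = 1 := by rw [hy]; norm_num
    have hi : inner ℝ (x : E3) (y : E3)
        = x.1 0 * y.1 0 + x.1 1 * y.1 1 + x.1 2 * y.1 2 := by
      simp [PiLp.inner_apply, Fin.sum_univ_three, mul_comm]
    rw [EuclideanSpace.real_norm_sq_eq, Fin.sum_univ_three] at hx2 hy2
    have hc : (inner ℝ (x : E3) (y : E3)) ^ 2 = 1 := by
      rw [hi]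
      -- Lagrange's identity: with zero cross product, the inner product of two unit vectors is `±
      -- 1`.
      have : (x.1 0 * y.1 0 + x.1 1 * y.1 1 + x.1 2 * y.1 2) ^ 2
        = (x.1 0 ^ 2 + x.1 1 ^ 2 + x.1 2 ^ 2) * (y.1 0 ^ 2 + y.1 1 ^ 2 + y.1 2 ^ 2)
        - (x.1 0 * y.1 1 - x.1 1 * y.1 0) ^ 2 - (-(x.1 0 * y.1 2) + x.1 2 * y.1 0) ^ 2
        - (x.1 1 * y.1 2 - x.1 2 * y.1 1) ^ 2 := by ring
      rw [this, hx2, hy2]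
      rw [show x.1 0 * y.1 1 - x.1 1 * y.1 0 = 0 by linarith,
        show -(x.1 0 * y.1 2) + x.1 2 * y.1 0 = 0 by linarith,
        show x.1 1 * y.1 2 - x.1 2 * y.1 1 = 0 by linarith]
      norm_num
    rcases sq_eq_one_iff.1 hc with h | h
    · exact h1 (Subtype.ext ((inner_eq_one_iff_of_norm_eq_one hx hy).1 h).symm)
    · refine h2 (Subtype.ext ?_)
      have h4 : inner ℝ (y : E3) (-x : E3) = 1 := by
        rw [inner_neg_right, real_inner_comm, h, neg_neg]
      exact (inner_eq_one_iff_of_norm_eq_one hy (by simp)).1 h4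
  exact mu_submodule hf

/-- Tonelli: integrating the indicator over coordinate `k` first already gives 0. -/
theorem pi_null_of_sections {ι X : Type*} [Fintype ι] [DecidableEq ι] [MeasurableSpace X]
    (ν : Measure X) [SigmaFinite ν] (k : ι) {s : Set (ι → X)} (hs : MeasurableSet s)
    (h : ∀ x, ν {z | Function.update x k z ∈ s} = 0) : Measure.pi (fun _ : ι => ν) s = 0 := by
  have hm : Measurable (s.indicator (1 : (ι → X) → ENNReal)) := measurable_one.indicator hs
  have h1 := lmarginal_erase' (μ := fun _ : ι => ν) _ hm (Finset.mem_univ k)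
  have h2 : (fun x => ∫⁻ z, s.indicator (1 : (ι → X) → ENNReal) (Function.update x k z) ∂ν) = 0 := by
    ext x
    exact (lintegral_indicator_one (hs.preimage (measurable_update x))).trans (h x)
  rw [h2, lmarginal_univ] at h1
  by_cases hne : Nonempty (ι → X)
  · obtain ⟨x⟩ := hne
    have h4 := congrFun h1 x
    rw [lintegral_indicator_one hs] at h4
    rw [h4]
    simp [lmarginal]
  · rw [not_nonempty_iff] at hne
    simp [Set.eq_empty_of_isEmpty s]

theorem pi_det3_eq_zero {i j k : Fin 4} (hij : i ≠ j) (hik : i ≠ k) (hjk : j ≠ k) :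
    Measure.pi (fun _ : Fin 4 => mu) {x | det3 (x i) (x j) (x k) = 0} = 0 := by
  have hA : IsClosed {x : Fin 4 → S2 | x j = x i ∨ x j = -x i} :=
    (isClosed_eq (by fun_prop) (by fun_prop)).union (isClosed_eq (by fun_prop) (by fun_prop))
  have hB : IsClosed {x : Fin 4 → S2 | det3 (x i) (x j) (x k) = 0} :=
    isClosed_eq (by unfold det3; fun_prop) (by fun_prop)
  -- Pairs with `x j = ± x i` are removed first, since there the determinant vanishes for every
  -- third point.
  have h1 : Measure.pi (fun _ : Fin 4 => mu) {x | x j = x i ∨ x j = -x i} = 0 := by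
    refine pi_null_of_sections mu j hA.measurableSet fun x => ?_
    simp only [Set.mem_ofPred_eq, Function.update_self, Function.update_of_ne hij]
    refine measure_union_null (s := {z | z = x i}) (t := {z | z = -x i}) ?_ ?_
    · exact mu_singleton _
    · exact mu_singleton _
  have h2 : Measure.pi (fun _ : Fin 4 => mu) ({x | det3 (x i) (x j) (x k) = 0} \
      {x | x j = x i ∨ x j = -x i}) = 0 := by
    refine pi_null_of_sections mu k (hB.measurableSet.diff hA.measurableSet) fun x => ?_
    simp only [Set.mem_sdiff, Set.mem_ofPred_eq, Function.update_self, Function.update_of_ne hik,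
      Function.update_of_ne hjk, not_or]
    by_cases h : x j ≠ x i ∧ x j ≠ -x i
    · exact measure_mono_null (fun z hz => hz.1) (mu_det3_eq_zero h.1 h.2)
    · convert measure_empty (μ := mu)
      ext z
      simp only [Set.mem_ofPred_eq, Set.mem_empty_iff_false, iff_false]
      exact fun hz => h hz.2
  refine measure_mono_null ?_ (measure_union_null h1 h2)
  intro x hx
  by_cases h : x ∈ {x : Fin 4 → S2 | x j = x i ∨ x j = -x i}
  · exact Or.inl h
  · exact Or.inr ⟨hx, h⟩

/-! ### Stability of crossings. -/

/-- Configurations whose arcs cross transversally, described by signs of determinants. -/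
def stableCrossing : Set (Fin 4 → S2) :=
  {x | (0 < det3 (x 1) (x 2) (x 3) ∧ det3 (x 0) (x 2) (x 3) < 0 ∧ det3 (x 0) (x 1) (x 3) < 0 ∧
      0 < det3 (x 0) (x 1) (x 2)) ∨
    (det3 (x 1) (x 2) (x 3) < 0 ∧ 0 < det3 (x 0) (x 2) (x 3) ∧ 0 < det3 (x 0) (x 1) (x 3) ∧
      det3 (x 0) (x 1) (x 2) < 0)}

theorem isOpen_stableCrossing : IsOpen stableCrossing := by
  have h : ∀ i j k : Fin 4, Continuous fun x : Fin 4 → S2 => det3 (x i) (x j) (x k) := by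
    intro i j k
    unfold det3
    fun_prop
  refine IsOpen.union ?_ ?_
  · exact (isOpen_lt (by fun_prop) (h 1 2 3)).inter ((isOpen_lt (h 0 2 3) (by fun_prop)).inter
      ((isOpen_lt (h 0 1 3) (by fun_prop)).inter (isOpen_lt (by fun_prop) (h 0 1 2))))
  · exact (isOpen_lt (h 1 2 3) (by fun_prop)).inter ((isOpen_lt (by fun_prop) (h 0 2 3)).inter
      ((isOpen_lt (by fun_prop) (h 0 1 3)).inter (isOpen_lt (h 0 1 2) (by fun_prop))))

/-- Cramer's linear dependence among four vectors in 3-space. On `stableCrossing` its four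
coefficients have one common sign, so it exhibits a vector in both cones. -/
theorem det3_relation (x y z t : E3) :
    det3 y z t • x + (-det3 x z t) • y = (-det3 x y t) • z + det3 x y z • t := by
  ext i
  fin_cases i <;> simp [det3] <;> ring

/-- The common vector, normalized, is the crossing point; the nonzero determinants keep it off the
lines through the four endpoints. -/
theorem crosses_of_pos {x₁ x₂ x₃ x₄ : S2} {a b c d : ℝ} (ha : 0 < a) (hb : 0 < b) (hc : 0 < c)
    (hd : 0 < d) (h : a • (x₁ : E3) + b • (x₂ : E3) = c • (x₃ : E3) + d • (x₄ : E3))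
    (h1 : det3 x₂ x₃ x₄ ≠ 0) (h2 : det3 x₁ x₃ x₄ ≠ 0) (h3 : det3 x₁ x₂ x₄ ≠ 0)
    (h4 : det3 x₁ x₂ x₃ ≠ 0) : Crosses x₁ x₂ x₃ x₄ := by
  set q : E3 := a • (x₁ : E3) + b • (x₂ : E3) with hq
  have hn1 : ∀ r : ℝ, q ≠ r • (x₁ : E3) := by
    intro r hr
    -- This functional kills `x₁` and `x₃`, so only the `x₄` term of `q` survives.
    have := congrArg (fun z => det3 x₁ x₃ z) hr
    rw [h] at this
    have h5 : d * det3 x₁ x₃ x₄ = 0 := by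
      simp only [det3, PiLp.add_apply, PiLp.smul_apply, smul_eq_mul] at this ⊢
      linarith
    exact (mul_ne_zero hd.ne' h2) h5
  have hn2 : ∀ r : ℝ, q ≠ r • (x₂ : E3) := by
    intro r hr
    have := congrArg (fun z => det3 x₂ x₃ z) hr
    rw [h] at this
    have h5 : d * det3 x₂ x₃ x₄ = 0 := by
      simp only [det3, PiLp.add_apply, PiLp.smul_apply, smul_eq_mul] at this ⊢
      linarith
    exact (mul_ne_zero hd.ne' h1) h5
  have hn3 : ∀ r : ℝ, q ≠ r • (x₃ : E3) := by
    intro r hr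
    have := congrArg (fun z => det3 x₁ z x₃) hr
    have h5 : b * det3 x₁ x₂ x₃ = 0 := by
      simp only [hq, det3, PiLp.add_apply, PiLp.smul_apply, smul_eq_mul] at this ⊢
      linarith
    exact (mul_ne_zero hb.ne' h4) h5
  have hn4 : ∀ r : ℝ, q ≠ r • (x₄ : E3) := by
    intro r hr
    have := congrArg (fun z => det3 x₁ z x₄) hr
    have h5 : b * det3 x₁ x₂ x₄ = 0 := by
      simp only [hq, det3, PiLp.add_apply, PiLp.smul_apply, smul_eq_mul] at this ⊢
      linarith
    exact (mul_ne_zero hb.ne' h3) h5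
  have hq0 : q ≠ 0 := by simpa using hn1 0
  have hqn : 0 < ‖q‖ := norm_pos_iff.2 hq0
  let p : S2 := ⟨‖q‖⁻¹ • q, by simp [norm_smul, hqn.ne']⟩
  have hp : ∀ y : S2, (∀ r : ℝ, q ≠ r • (y : E3)) → p ≠ y := by
    rintro y hy rfl
    refine hy ‖q‖ ?_
    simp [p, smul_smul, hqn.ne']
  refine ⟨p, ⟨⟨‖q‖⁻¹ * a, ‖q‖⁻¹ * b, by positivity, by positivity, ?_⟩, ?_⟩,
    ⟨⟨‖q‖⁻¹ * c, ‖q‖⁻¹ * d, by positivity, by positivity, ?_⟩, ?_⟩⟩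
  · simp [p, hq, mul_smul]
  · simpa using ⟨hp _ hn1, hp _ hn2⟩
  · simp [p, h, mul_smul]
  · simpa using ⟨hp _ hn3, hp _ hn4⟩

theorem crosses_of_mem_stableCrossing {x : Fin 4 → S2} (hx : x ∈ stableCrossing) :
    Crosses (x 0) (x 1) (x 2) (x 3) := by
  have hr := det3_relation (x 0) (x 1) (x 2) (x 3)
  rcases hx with ⟨h1, h2, h3, h4⟩ | ⟨h1, h2, h3, h4⟩
  · exact crosses_of_pos h1 (neg_pos.2 h2) (neg_pos.2 h3) h4 hr h1.ne' h2.ne h3.ne h4.ne'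
  · refine crosses_of_pos (neg_pos.2 h1) h2 h3 (neg_pos.2 h4) ?_ h1.ne h2.ne' h3.ne' h4.ne
    have := congrArg Neg.neg hr
    rw [neg_add, neg_add, ← neg_smul, ← neg_smul, ← neg_smul, ← neg_smul, neg_neg, neg_neg] at this
    exact this

/-- Determinants of the equation `c x₂ + d x₃ = a x₀ + b x₁` at the common point express the other
three as multiples of `det3 (x 1) (x 2) (x 3)`, with signs fixed by `a, b, c, d ≥ 0`. -/
theorem mem_stableCrossing_of_crosses {x : Fin 4 → S2} (hx : Crosses (x 0) (x 1) (x 2) (x 3))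
    (h1 : det3 (x 1) (x 2) (x 3) ≠ 0) (h2 : det3 (x 0) (x 2) (x 3) ≠ 0)
    (h3 : det3 (x 0) (x 1) (x 3) ≠ 0) (h4 : det3 (x 0) (x 1) (x 2) ≠ 0) :
    x ∈ stableCrossing := by
  obtain ⟨q, ⟨⟨a, b, ha, hb, hab⟩, -⟩, ⟨⟨c, d, hc, hd, hcd⟩, -⟩⟩ := hx
  have hq : (q : E3) ≠ 0 := ne_zero_of_mem_unit_sphere q
  rw [hcd] at hab
  have i0 := congrArg (fun z => det3 z (x 2) (x 3)) hab
  have i1 := congrArg (fun z => det3 z (x 1) (x 2)) hab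
  have i2 := congrArg (fun z => det3 z (x 1) (x 3)) hab
  have j0 : a * det3 (x 0) (x 2) (x 3) = -(b * det3 (x 1) (x 2) (x 3)) := by
    simp only [det3, PiLp.add_apply, PiLp.smul_apply, smul_eq_mul] at i0 ⊢
    linarith
  have j1 : a * det3 (x 0) (x 1) (x 2) = d * det3 (x 1) (x 2) (x 3) := by
    simp only [det3, PiLp.add_apply, PiLp.smul_apply, smul_eq_mul] at i1 ⊢
    linarith
  have j2 : a * det3 (x 0) (x 1) (x 3) = -(c * det3 (x 1) (x 2) (x 3)) := by
    simp only [det3, PiLp.add_apply, PiLp.smul_apply, smul_eq_mul] at i2 ⊢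
    linarith
  have ha' : 0 < a := by
    refine lt_of_le_of_ne ha fun h => ?_
    subst h
    have hd0 : d = 0 := by simpa [h1] using j1.symm
    have hc0 : c = 0 := by simpa [h1] using j2.symm
    exact hq (by simp [hcd, hc0, hd0])
  have s0 : det3 (x 0) (x 2) (x 3) = -(b / a * det3 (x 1) (x 2) (x 3)) := by
    field_simp; linarith
  have s1 : det3 (x 0) (x 1) (x 2) = d / a * det3 (x 1) (x 2) (x 3) := by
    field_simp; linarith
  have s2 : det3 (x 0) (x 1) (x 3) = -(c / a * det3 (x 1) (x 2) (x 3)) := by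
    field_simp; linarith
  have hb' : 0 < b / a := lt_of_le_of_ne (by positivity) fun h => h2 (by rw [s0, ← h]; simp)
  have hd' : 0 < d / a := lt_of_le_of_ne (by positivity) fun h => h4 (by rw [s1, ← h]; simp)
  have hc' : 0 < c / a := lt_of_le_of_ne (by positivity) fun h => h3 (by rw [s2, ← h]; simp)
  rcases lt_or_gt_of_ne h1 with h | h
  · refine Or.inr ⟨h, ?_, ?_, ?_⟩
    · rw [s0]; linarith [mul_neg_of_pos_of_neg hb' h]
    · rw [s2]; linarith [mul_neg_of_pos_of_neg hc' h]
    · rw [s1]; exact mul_neg_of_pos_of_neg hd' h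
  · refine Or.inl ⟨h, ?_, ?_, ?_⟩
    · rw [s0]; linarith [mul_pos hb' h]
    · rw [s2]; linarith [mul_pos hc' h]
    · rw [s1]; exact mul_pos hd' h

theorem pi_crosses_diff_stableCrossing :
    Measure.pi (fun _ : Fin 4 => mu)
      ({x | Crosses (x 0) (x 1) (x 2) (x 3)} \ stableCrossing) = 0 := by
  refine measure_mono_null ?_ (measure_union_null (measure_union_null
    (pi_det3_eq_zero (i := 1) (j := 2) (k := 3) (by decide) (by decide) (by decide))
    (pi_det3_eq_zero (i := 0) (j := 2) (k := 3) (by decide) (by decide) (by decide)))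
    (measure_union_null
    (pi_det3_eq_zero (i := 0) (j := 1) (k := 3) (by decide) (by decide) (by decide))
    (pi_det3_eq_zero (i := 0) (j := 1) (k := 2) (by decide) (by decide) (by decide))))
  rintro x ⟨hx, hn⟩
  by_contra hcon
  simp only [Set.mem_union, Set.mem_ofPred_eq, not_or] at hcon
  exact hn (mem_stableCrossing_of_crosses hx hcon.1.1 hcon.1.2 hcon.2.1 hcon.2.2)

/-- Up to a set of small measure, crossing is stable under small perturbations. -/
theorem exists_compact_stable {ε : ℝ} (hε : 0 < ε) :
    ∃ K : Set (Fin 4 → S2), IsCompact K ∧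
      (Measure.pi fun _ : Fin 4 => mu).real ({x | Crosses (x 0) (x 1) (x 2) (x 3)} \ K) ≤ ε ∧
      ∃ η : ℝ, 0 < η ∧ ∀ x ∈ K, ∀ y : Fin 4 → S2, (∀ i, dist (x i) (y i) < η) →
        Crosses (y 0) (y 1) (y 2) (y 3) := by
  obtain ⟨K, hKV, hK, hlt⟩ := isOpen_stableCrossing.measurableSet.exists_isCompact_sdiff_lt
    (μ := Measure.pi fun _ : Fin 4 => mu) (measure_ne_top _ _) (ε := ENNReal.ofReal ε) (by simpa)
  obtain ⟨η, hη, hsub⟩ := hK.exists_thickening_subset_open isOpen_stableCrossing hKV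
  refine ⟨K, hK, ?_, η, hη, fun x hx y hxy => ?_⟩
  · refine ENNReal.toReal_le_of_le_ofReal hε.le ?_
    calc _ ≤ Measure.pi (fun _ : Fin 4 => mu)
          (({x | Crosses (x 0) (x 1) (x 2) (x 3)} \ stableCrossing) ∪ (stableCrossing \ K)) :=
          measure_mono fun x hx => by
            by_cases h : x ∈ stableCrossing
            · exact Or.inr ⟨h, hx.2⟩
            · exact Or.inl ⟨hx.1, h⟩
      _ ≤ _ := (measure_union_le _ _).trans (by
            rw [pi_crosses_diff_stableCrossing, zero_add]; exact hlt.le)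
  · refine crosses_of_mem_stableCrossing (hsub (Metric.mem_thickening_iff.2 ⟨x, hx, ?_⟩))
    rw [dist_comm]
    exact (dist_pi_lt_iff hη).2 hxy

/-! ### Rotation invariance of `mu`. -/

/-- The action of a linear isometry on the sphere. -/
noncomputable def sphereMap (L : E3 ≃ₗᵢ[ℝ] E3) (x : S2) : S2 := ⟨L x, by simp⟩

theorem continuous_sphereMap (L : E3 ≃ₗᵢ[ℝ] E3) : Continuous (sphereMap L) :=
  (L.continuous.comp continuous_subtype_val).subtype_mk _

/-- The area of a set is, up to a constant, the volume of the cone over it; isometries preserve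
volume and commute with forming the cone. -/
theorem measurePreserving_sphereMap (L : E3 ≃ₗᵢ[ℝ] E3) : MeasurePreserving (sphereMap L) mu mu := by
  have hm := (continuous_sphereMap L).measurable
  refine ⟨hm, ?_⟩
  ext s hs
  rw [Measure.map_apply hm hs, mu, Measure.smul_apply, Measure.smul_apply, area,
    Measure.toSphere_apply' _ hs, Measure.toSphere_apply' _ (hm hs)]
  congr 2
  have h : Set.Ioo (0 : ℝ) 1 • (((↑) : S2 → E3) '' (sphereMap L ⁻¹' s))
      = L ⁻¹' (Set.Ioo (0 : ℝ) 1 • (((↑) : S2 → E3) '' s)) := by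
    ext z
    constructor
    · rintro ⟨t, ht, _, ⟨x, hx, rfl⟩, rfl⟩
      exact ⟨t, ht, _, ⟨sphereMap L x, hx, rfl⟩, by simp [sphereMap]⟩
    · rintro ⟨t, ht, _, ⟨x, hx, rfl⟩, hz⟩
      refine ⟨t, ht, _, ⟨sphereMap L.symm x, ?_, rfl⟩, ?_⟩
      · have : sphereMap L (sphereMap L.symm x) = x := Subtype.ext (by simp [sphereMap])
        simpa [this] using hx
      · apply L.injective
        simpa [sphereMap] using hz
  rw [h, L.measurePreserving.measure_preimage_emb L.toHomeomorph.measurableEmbedding]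

theorem exists_sphereMap_eq (x y : S2) : ∃ L : E3 ≃ₗᵢ[ℝ] E3, sphereMap L x = y :=
  ⟨_, Subtype.ext (Submodule.reflection_sub (v := (x : E3)) (w := (y : E3)) (by simp))⟩

/-- A reflection carries `u` to `v`. Hence one constant normalizes the bumps at all centres. -/
theorem integral_dist_eq {f : ℝ → ℝ} (u v : S2) :
    ∫ x, f (dist x u) ∂mu = ∫ x, f (dist x v) ∂mu := by
  obtain ⟨L, rfl⟩ := exists_sphereMap_eq u v
  have hemb : MeasurableEmbedding (sphereMap L) :=
    (continuous_sphereMap L).measurableEmbedding fun x y h =>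
      Subtype.ext (L.injective (congrArg Subtype.val h))
  have h : ∀ x, dist (sphereMap L x) (sphereMap L u) = dist x u := fun x => by
    simp only [sphereMap, Subtype.dist_eq, L.dist_map]
  rw [← (measurePreserving_sphereMap L).integral_comp hemb fun y => f (dist y (sphereMap L u))]
  simp only [h]

/-! ### The mollifier. -/

instance : mu.IsOpenPosMeasure := by
  unfold mu area
  exact Measure.isOpenPosMeasure_smul _ (by simpa using Real.pi_pos)

/-- The unnormalized bump of radius `η` around `v`. -/
noncomputable def bump (η : ℝ) (x v : S2) : ℝ := expNegInvGlue (η ^ 2 - dist x v ^ 2)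

theorem continuous_bump (η : ℝ) : Continuous (Function.uncurry (bump η)) :=
  (expNegInvGlue.contDiff (n := 0)).continuous.comp
    (f := fun p : S2 × S2 => η ^ 2 - dist p.1 p.2 ^ 2) (by fun_prop)

/-- The mass of a bump. -/
noncomputable def bumpMass (η : ℝ) : ℝ :=
  ∫ x, bump η x ⟨EuclideanSpace.single 0 1, by simp⟩ ∂mu

theorem integral_bump (η : ℝ) (v : S2) : ∫ x, bump η x v ∂mu = bumpMass η :=
  integral_dist_eq (f := fun r => expNegInvGlue (η ^ 2 - r ^ 2)) _ _

theorem bumpMass_pos {η : ℝ} (hη : 0 < η) : 0 < bumpMass η := by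
  obtain ⟨v⟩ : Nonempty S2 := ⟨⟨EuclideanSpace.single 0 1, by simp⟩⟩
  have hc : Continuous fun x => bump η x v :=
    (continuous_bump η).comp (f := fun x => (x, v)) (by fun_prop)
  rw [← integral_bump η v]
  have hv : bump η v v ≠ 0 := (expNegInvGlue.pos_of_pos (by simp; positivity)).ne'
  have h0 : 0 ≤ fun x => bump η x v := fun x => expNegInvGlue.nonneg _
  exact hc.integral_pos_of_hasCompactSupport_nonneg_nonzero
    (HasCompactSupport.of_compactSpace _) h0 hv

/-- The rotation-invariant smooth mollifier of radius `η` on the sphere. -/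
noncomputable def mollifier (η : ℝ) (x v : S2) : ℝ := (bumpMass η)⁻¹ * bump η x v

theorem continuous_mollifier (η : ℝ) : Continuous (Function.uncurry (mollifier η)) :=
  continuous_const.mul (continuous_bump η)

theorem mollifier_comm (η : ℝ) (x v : S2) : mollifier η x v = mollifier η v x := by
  simp [mollifier, bump, dist_comm]

theorem mollifier_nonneg {η : ℝ} (hη : 0 < η) (x v : S2) : 0 ≤ mollifier η x v :=
  mul_nonneg (inv_nonneg.2 (bumpMass_pos hη).le) (expNegInvGlue.nonneg _)

theorem integral_mollifier {η : ℝ} (hη : 0 < η) (v : S2) : ∫ x, mollifier η x v ∂mu = 1 := by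
  simp only [mollifier]
  rw [integral_const_mul, integral_bump, inv_mul_cancel₀ (bumpMass_pos hη).ne']

theorem dist_lt_of_mollifier_ne_zero {η : ℝ} (hη : 0 < η) {x v : S2} (h : mollifier η x v ≠ 0) :
    dist x v < η := by
  by_contra hle
  refine h ?_
  rw [mollifier, bump, expNegInvGlue.zero_of_nonpos, mul_zero]
  have := pow_le_pow_left₀ hη.le (not_lt.1 hle) 2
  linarith

/-- The squared chordal distance is the restriction of a smooth function on the ambient space. -/
theorem contMDiff_mollifier (η : ℝ) (v : S2) :
    ContMDiff (𝓡 2) 𝓘(ℝ, ℝ) ∞ fun x => mollifier η x v := by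
  have h : ContDiff ℝ ∞ fun z : E3 => (bumpMass η)⁻¹ * expNegInvGlue (η ^ 2 - ‖z - v‖ ^ 2) := by
    refine contDiff_const.mul (expNegInvGlue.contDiff.comp ?_)
    exact contDiff_const.sub ((contDiff_id.sub contDiff_const).norm_sq ℝ)
  have : Fact (Module.finrank ℝ E3 = 2 + 1) := ⟨finrank_euclideanSpace_fin⟩
  have hcoe : ContMDiff (𝓡 2) 𝓘(ℝ, E3) ∞ ((↑) : S2 → E3) := contMDiff_coe_sphere
  refine (h.contMDiff.comp hcoe).congr fun x => ?_
  simp [mollifier, bump, Subtype.dist_eq, dist_eq_norm]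

/-! ### Smoothed densities and kernels. -/

section Smoothing

variable {V : Type*} [Fintype V]

/-- The smoothed vertex density. -/
noncomputable def smoothDensity (η : ℝ) (p : V → S2) (x : S2) : ℝ :=
  (1 / (Fintype.card V : ℝ)) * ∑ v, mollifier η x (p v)

open Classical in
/-- The smoothed edge density. -/
noncomputable def smoothKernel (η : ℝ) (G : SimpleGraph V) (p : V → S2) (x y : S2) : ℝ :=
  (1 / (Fintype.card V : ℝ) ^ 2) *
    ∑ e : V × V with G.Adj e.1 e.2, mollifier η x (p e.1) * mollifier η y (p e.2)

theorem contMDiff_smoothDensity (η : ℝ) (p : V → S2) :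
    ContMDiff (𝓡 2) 𝓘(ℝ, ℝ) ∞ (smoothDensity η p) :=
  contMDiff_const.mul (contMDiff_finsetSum fun _ _ => contMDiff_mollifier _ _)

theorem contMDiff_smoothKernel (η : ℝ) (G : SimpleGraph V) (p : V → S2) :
    ContMDiff ((𝓡 2).prod (𝓡 2)) 𝓘(ℝ, ℝ) ∞ (Function.uncurry (smoothKernel η G p)) :=
  contMDiff_const.mul (contMDiff_finsetSum fun _ _ =>
    ((contMDiff_mollifier _ _).comp contMDiff_fst).mul
      ((contMDiff_mollifier _ _).comp contMDiff_snd))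

theorem smoothDensity_nonneg {η : ℝ} (hη : 0 < η) (p : V → S2) (x : S2) :
    0 ≤ smoothDensity η p x :=
  mul_nonneg (by positivity) (Finset.sum_nonneg fun _ _ => mollifier_nonneg hη _ _)

theorem smoothKernel_nonneg {η : ℝ} (hη : 0 < η) (G : SimpleGraph V) (p : V → S2) (x y : S2) :
    0 ≤ smoothKernel η G p x y :=
  mul_nonneg (by positivity) (Finset.sum_nonneg fun _ _ =>
    mul_nonneg (mollifier_nonneg hη _ _) (mollifier_nonneg hη _ _))

theorem smoothKernel_le {η : ℝ} (hη : 0 < η) (G : SimpleGraph V) (p : V → S2) (x y : S2) :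
    smoothKernel η G p x y ≤ smoothDensity η p x * smoothDensity η p y := by
  classical
  have h : smoothDensity η p x * smoothDensity η p y = (1 / (Fintype.card V : ℝ) ^ 2) *
      ∑ e : V × V, mollifier η x (p e.1) * mollifier η y (p e.2) := by
    simp only [Fintype.sum_prod_type, ← Finset.mul_sum, ← Finset.sum_mul, smoothDensity]
    ring
  rw [h]
  refine mul_le_mul_of_nonneg_left ?_ (by positivity)
  exact Finset.sum_le_sum_of_subset_of_nonneg (Finset.filter_subset _ _) fun _ _ _ =>
    mul_nonneg (mollifier_nonneg hη _ _) (mollifier_nonneg hη _ _)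

theorem smoothKernel_comm (η : ℝ) (G : SimpleGraph V) (p : V → S2) (x y : S2) :
    smoothKernel η G p x y = smoothKernel η G p y x := by
  classical
  unfold smoothKernel
  congr 1
  refine Finset.sum_equiv (Equiv.prodComm V V) (fun e => ?_) fun e _ => mul_comm _ _
  simp [G.adj_comm]

theorem continuous_mollifier_left (η : ℝ) (v : S2) : Continuous fun x => mollifier η x v :=
  (contMDiff_mollifier η v).continuous

theorem integrable_mollifier (η : ℝ) (v : S2) : Integrable (fun x => mollifier η x v) mu :=
  (continuous_mollifier_left η v).integrable_of_hasCompactSupport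
    (HasCompactSupport.of_compactSpace _)

theorem integral_smoothDensity {η : ℝ} (hη : 0 < η) [Nonempty V] (p : V → S2) :
    ∫ x, smoothDensity η p x ∂mu = 1 := by
  unfold smoothDensity
  rw [integral_const_mul, integral_finsetSum _ fun _ _ => integrable_mollifier _ _]
  simp [integral_mollifier hη]

theorem edgeDensity_smoothKernel {η : ℝ} (hη : 0 < η) (G : SimpleGraph V) (p : V → S2) :
    edgeDensity (smoothKernel η G p)
      = 2 * (G.edgeSet.ncard : ℝ) / (Fintype.card V : ℝ) ^ 2 := by
  classical
  have h : ∀ x, ∫ y, smoothKernel η G p x y ∂mu = (1 / (Fintype.card V : ℝ) ^ 2) *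
      ∑ e : V × V with G.Adj e.1 e.2, mollifier η x (p e.1) := by
    intro x
    unfold smoothKernel
    rw [integral_const_mul,
      integral_finsetSum _ fun _ _ => (integrable_mollifier _ _).const_mul _]
    simp_rw [integral_const_mul, integral_mollifier hη, mul_one]
  unfold edgeDensity
  simp_rw [h]
  rw [integral_const_mul, integral_finsetSum _ fun _ _ => integrable_mollifier _ _]
  simp_rw [integral_mollifier hη]
  have h2 : (2 * G.edgeFinset.card : ℝ) = ((Finset.univ.filter fun e : V × V => G.Adj e.1 e.2).card : ℝ) := by
    exact_mod_cast G.two_mul_card_edgeFinset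
  rw [Finset.sum_const, nsmul_eq_mul, mul_one, ← h2, ← SimpleGraph.coe_edgeFinset,
    Set.ncard_coe_finset]
  ring

end Smoothing

/-! ### Uniform convergence of the vertex density. -/

theorem continuous_smoothDensity {V : Type*} [Fintype V] (η : ℝ) (p : V → S2) :
    Continuous (smoothDensity η p) := (contMDiff_smoothDensity η p).continuous

/-- Weak convergence, tested on a mollifier, gives pointwise convergence. The densities share the
modulus of continuity of the mollifier, so a finite net makes it uniform. -/
theorem eventually_smoothDensity {V : ℕ → Type*} [∀ n, Fintype (V n)] {G : ∀ n, SimpleGraph (V n)}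
    {D : ∀ n, GeodesicDrawing (G n)} (hD : IsUniform D) {η : ℝ} (hη : 0 < η) {ε : ℝ}
    (hε : 0 < ε) : ∀ᶠ n in atTop, ∀ x, |smoothDensity η (D n).pos x - 1| ≤ ε := by
  have hlim : ∀ x, Tendsto (fun n => smoothDensity η (D n).pos x) atTop (𝓝 1) := by
    intro x
    have h := hD.2 (fun v => mollifier η v x) (continuous_mollifier_left η x)
    rw [integral_mollifier hη] at h
    refine h.congr fun n => ?_
    simp [smoothDensity, hD.1 n, mollifier_comm η x]
  have huc := CompactSpace.uniformContinuous_of_continuous (continuous_mollifier η)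
  obtain ⟨r, hr, hK⟩ := Metric.uniformContinuous_iff.1 huc (ε / 2) (by positivity)
  obtain ⟨t, -, ht, hcov⟩ := Metric.totallyBounded_iff.1 (isCompact_univ (X := S2)).totallyBounded r hr |>.imp
    fun t h => (⟨trivial, h.1, h.2⟩ : True ∧ _ ∧ _)
  have hev : ∀ᶠ n in atTop, ∀ c ∈ t, |smoothDensity η (D n).pos c - 1| < ε / 2 :=
    (ht.eventually_all).2 fun c _ => by
      simpa [Real.dist_eq] using Metric.tendsto_nhds.1 (hlim c) (ε / 2) (by positivity)
  filter_upwards [hev, eventually_gt_atTop 0] with n hn hn0 x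
  obtain ⟨c, hc, hxc⟩ := Set.mem_iUnion₂.1 (hcov (Set.mem_univ x))
  have h1 : |smoothDensity η (D n).pos x - smoothDensity η (D n).pos c| ≤ ε / 2 := by
    unfold smoothDensity
    rw [hD.1 n, ← mul_sub, ← Finset.sum_sub_distrib, abs_mul, abs_of_nonneg (by positivity)]
    have h2 : |∑ v, (mollifier η x ((D n).pos v) - mollifier η c ((D n).pos v))|
        ≤ n * (ε / 2) := by
      refine (Finset.abs_sum_le_sum_abs _ _).trans ((Finset.sum_le_card_nsmul _ _ (ε / 2)
        fun v _ => ?_).trans_eq (by rw [Finset.card_univ, hD.1 n, nsmul_eq_mul]))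
      have h3 := @hK (x, (D n).pos v) (c, (D n).pos v) (by simpa [Prod.dist_eq, hr] using hxc)
      exact (Real.dist_eq _ _ ▸ h3).le
    have hn' : (0 : ℝ) < n := by exact_mod_cast hn0
    calc _ ≤ 1 / (n : ℝ) * (n * (ε / 2)) := by gcongr
      _ = ε / 2 := by field_simp
  calc _ = |(smoothDensity η (D n).pos x - smoothDensity η (D n).pos c)
        + (smoothDensity η (D n).pos c - 1)| := by congr 1; ring
    _ ≤ _ := (abs_add_le _ _).trans (by linarith [hn c hc])

/-! ### Counting crossing pairs of edges. -/

theorem geodesicInterior_congr {V : Type*} {p : V → S2} {a b c d : V} (h : s(a, b) = s(c, d)) :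
    geodesicInterior (p a) (p b) = geodesicInterior (p c) (p d) := by
  rcases Sym2.eq_iff.1 h with ⟨rfl, rfl⟩ | ⟨rfl, rfl⟩
  · rfl
  · ext z
    simp only [geodesicInterior, geodesicSegment, Set.mem_sdiff, Set.mem_ofPred_eq,
      Set.pair_comm (p a)]
    refine and_congr_left fun _ => ?_
    constructor <;> rintro ⟨s, t, hs, ht, h⟩ <;> exact ⟨t, s, ht, hs, by rw [h, add_comm]⟩

open Classical in
/-- The ordered pairs of oriented edges that cross. -/
noncomputable def GeodesicDrawing.crossingTuples {V : Type*} [Fintype V] {G : SimpleGraph V}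
    (D : GeodesicDrawing G) : Finset ((V × V) × (V × V)) :=
  {t | G.Adj t.1.1 t.1.2 ∧ G.Adj t.2.1 t.2.2 ∧
    Crosses (D.pos t.1.1) (D.pos t.1.2) (D.pos t.2.1) (D.pos t.2.2)}

theorem card_filter_sym2_le {V : Type*} [Fintype V] [DecidableEq V] (e : V × V) :
    (Finset.univ.filter fun e' : V × V => s(e'.1, e'.2) = s(e.1, e.2)).card ≤ 2 := by
  refine (Finset.card_le_card (t := {e, e.swap}) fun e' he => ?_).trans Finset.card_le_two
  simp only [Finset.mem_filter, Finset.mem_univ, true_and, Sym2.eq_iff] at he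
  simp only [Finset.mem_insert, Finset.mem_singleton, Prod.ext_iff, Prod.fst_swap, Prod.snd_swap]
  exact he

/-- A crossing point determines its two edges, as no three share an interior point; the 8 counts
their order and two orientations each. The term `2 n ^ 2` absorbs pairs with the same underlying
edge, since an edge meets its own interior. -/
theorem GeodesicDrawing.card_crossingTuples_le {V : Type*} [Fintype V] {G : SimpleGraph V}
    (D : GeodesicDrawing G) :
    D.crossingTuples.card ≤ 8 * D.cr + 2 * Fintype.card V ^ 2 := by
  classical
  let same : Finset ((V × V) × (V × V)) := Finset.univ.filter fun t => s(t.2.1, t.2.2) = s(t.1.1, t.1.2)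
  have hsame : same.card ≤ 2 * Fintype.card V ^ 2 := by
    have := Finset.card_le_mul_card_image_of_maps_to (s := same) (t := Finset.univ)
      (f := fun t => t.1) (fun _ _ => Finset.mem_univ _) 2 fun e _ => by
        refine (Finset.card_le_card_of_injOn (fun t => t.2)
          (t := Finset.univ.filter fun e' : V × V => s(e'.1, e'.2) = s(e.1, e.2)) ?_ ?_).trans
          (card_filter_sym2_le e)
        · rintro t ht
          simp only [same, Finset.coe_filter, Finset.mem_filter, Finset.mem_univ, true_and,
            Set.mem_ofPred_eq] at ht ⊢
          rw [ht.1, ht.2]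
        · rintro t ht t' ht' h
          simp only [Finset.coe_filter, Set.mem_ofPred_eq] at ht ht'
          exact Prod.ext (ht.2.trans ht'.2.symm) h
    simpa [Finset.card_univ, sq] using this
  have hdiff : (D.crossingTuples \ same).card ≤ 8 * D.cr := by
    have hne : ∀ t ∈ D.crossingTuples \ same, s(t.1.1, t.1.2) ≠ s(t.2.1, t.2.2) ∧
        G.Adj t.1.1 t.1.2 ∧ G.Adj t.2.1 t.2.2 ∧
        Crosses (D.pos t.1.1) (D.pos t.1.2) (D.pos t.2.1) (D.pos t.2.2) := by
      intro t ht
      simp only [crossingTuples, same, Finset.mem_sdiff, Finset.mem_filter, Finset.mem_univ,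
        true_and] at ht
      exact ⟨fun h => ht.2 h.symm, ht.1⟩
    have hex : ∀ t : (V × V) × (V × V), ∃ q : S2, t ∈ D.crossingTuples \ same →
        q ∈ geodesicInterior (D.pos t.1.1) (D.pos t.1.2) ∩
          geodesicInterior (D.pos t.2.1) (D.pos t.2.2) := by
      intro t
      by_cases h : t ∈ D.crossingTuples \ same
      · obtain ⟨q, hq⟩ := (hne t h).2.2.2
        exact ⟨q, fun _ => hq⟩
      -- An arbitrary value for tuples that are not counted.
      · exact ⟨D.pos t.1.1, fun h' => absurd h' h⟩
    choose q hq using hex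
    rw [GeodesicDrawing.cr, Set.ncard_eq_toFinset_card _ D.finite_crossings]
    refine Finset.card_le_mul_card_image_of_maps_to (f := q) (fun t ht => ?_) 8 fun z _ => ?_
    · obtain ⟨h1, h2, h3, -⟩ := hne t ht
      rw [Set.Finite.mem_toFinset]
      refine ⟨?_, _, _, _, _, h2, h3, h1, (hq t ht).1.1, (hq t ht).2.1⟩
      rintro ⟨w, hw⟩
      exact D.no_vertex _ _ w h2 (hw ▸ (hq t ht).1)
    · rcases (Finset.filter (fun t => q t = z) (D.crossingTuples \ same)).eq_empty_or_nonempty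
        with h | ⟨t₀, ht₀⟩
      · simp [h]
      rw [Finset.mem_filter] at ht₀
      obtain ⟨ht₀, rfl⟩ := ht₀
      obtain ⟨a1, a2, a3, -⟩ := hne t₀ ht₀
      have hcls : ∀ u v, G.Adj u v → q t₀ ∈ geodesicInterior (D.pos u) (D.pos v) →
          s(u, v) = s(t₀.1.1, t₀.1.2) ∨ s(u, v) = s(t₀.2.1, t₀.2.2) := by
        intro u v huv hmem
        by_contra! hcon
        have := D.no_triple _ _ _ _ _ _ a2 a3 huv a1 hcon.1.symm hcon.2.symm
        exact (this ▸ ⟨hq t₀ ht₀, hmem⟩ : q t₀ ∈ (∅ : Set S2))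
      let F (e : V × V) : Finset (V × V) := Finset.univ.filter fun e' => s(e'.1, e'.2) = s(e.1, e.2)
      calc _ ≤ (F t₀.1 ×ˢ F t₀.2 ∪ F t₀.2 ×ˢ F t₀.1).card := Finset.card_le_card fun t ht => by
            rw [Finset.mem_filter] at ht
            obtain ⟨ht, htq⟩ := ht
            obtain ⟨b1, b2, b3, -⟩ := hne t ht
            have c1 := hcls _ _ b2 (htq ▸ (hq t ht).1)
            have c2 := hcls _ _ b3 (htq ▸ (hq t ht).2)
            simp only [F, Finset.mem_union, Finset.mem_product, Finset.mem_filter,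
              Finset.mem_univ, true_and]
            rcases c1 with c1 | c1 <;> rcases c2 with c2 | c2
            · exact absurd (c1.trans c2.symm) b1
            · exact Or.inl ⟨c1, c2⟩
            · exact Or.inr ⟨c1, c2⟩
            · exact absurd (c1.trans c2.symm) b1
        _ ≤ 2 * 2 + 2 * 2 := (Finset.card_union_le _ _).trans (by
            rw [Finset.card_product, Finset.card_product]
            exact add_le_add (Nat.mul_le_mul (card_filter_sym2_le _) (card_filter_sym2_le _))
              (Nat.mul_le_mul (card_filter_sym2_le _) (card_filter_sym2_le _)))
  calc D.crossingTuples.card ≤ (D.crossingTuples \ same ∪ same).card :=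
        Finset.card_le_card fun t ht => by
          by_cases h : t ∈ same <;> simp [h, ht]
    _ ≤ _ := (Finset.card_union_le _ _).trans (add_le_add hdiff hsame)

/-! ### Bounding the crossing functional. -/

/-- The positions of the four endpoints of a pair of oriented edges. -/
def endpoints {V : Type*} (p : V → S2) (t : (V × V) × (V × V)) : Fin 4 → S2 :=
  ![p t.1.1, p t.1.2, p t.2.1, p t.2.2]

theorem integral_prod_mollifier {η : ℝ} (hη : 0 < η) (q : Fin 4 → S2) :
    ∫ x : Fin 4 → S2, ∏ i, mollifier η (x i) (q i) ∂(Measure.pi fun _ => mu) = 1 := by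
  rw [integral_fintype_prod_eq_prod (f := fun i x => mollifier η x (q i))]
  simp [integral_mollifier hη]

theorem integrable_prod_mollifier (η : ℝ) (q : Fin 4 → S2) :
    Integrable (fun x : Fin 4 → S2 => ∏ i, mollifier η (x i) (q i)) (Measure.pi fun _ => mu) := by
  have h : Continuous fun x : Fin 4 → S2 => ∏ i, mollifier η (x i) (q i) :=
    continuous_finsetProd _ fun i _ => (continuous_mollifier_left η (q i)).comp (continuous_apply i)
  exact h.integrable_of_hasCompactSupport (HasCompactSupport.of_compactSpace _)

/-- On `K` the product of kernels expands over pairs of oriented edges, and a nonzero term has its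
endpoints within `η` of `x`, so that pair crosses. Off `K` the density bound gives `(1 + s) ^ 4`. -/
theorem crossingIntegrand_smoothKernel_le {V : Type*} [Fintype V] {G : SimpleGraph V}
    (D : GeodesicDrawing G) {η : ℝ} (hη : 0 < η) {K : Set (Fin 4 → S2)}
    (hK : ∀ x ∈ K, ∀ y : Fin 4 → S2, (∀ i, dist (x i) (y i) < η) →
      Crosses (y 0) (y 1) (y 2) (y 3))
    {s : ℝ} (hs : ∀ x, smoothDensity η D.pos x ≤ 1 + s) (x : Fin 4 → S2) :
    crossingIntegrand (smoothKernel η G D.pos) x ≤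
      ({x | Crosses (x 0) (x 1) (x 2) (x 3)} \ K).indicator (fun _ => (1 + s) ^ 4) x +
      (1 / (Fintype.card V : ℝ) ^ 4) *
        ∑ t ∈ D.crossingTuples, ∏ i, mollifier η (x i) (endpoints D.pos t i) := by
  classical
  have h0 : 0 ≤ (1 / (Fintype.card V : ℝ) ^ 4) *
        ∑ t ∈ D.crossingTuples, ∏ i, mollifier η (x i) (endpoints D.pos t i) :=
    mul_nonneg (by positivity) (Finset.sum_nonneg fun _ _ =>
      Finset.prod_nonneg fun _ _ => mollifier_nonneg hη _ _)
  by_cases hx : x ∈ {x : Fin 4 → S2 | Crosses (x 0) (x 1) (x 2) (x 3)}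
  · rw [crossingIntegrand, Set.indicator_of_mem hx]
    by_cases hxK : x ∈ K
    · rw [Set.indicator_of_notMem fun h => h.2 hxK, zero_add]
      refine le_of_eq ?_
      have hsub : D.crossingTuples ⊆ (Finset.univ.filter fun e : V × V => G.Adj e.1 e.2) ×ˢ
          (Finset.univ.filter fun e : V × V => G.Adj e.1 e.2) := fun t ht => by
        simp only [GeodesicDrawing.crossingTuples, Finset.mem_filter, Finset.mem_univ, true_and] at ht
        simp [ht.1, ht.2.1]
      rw [Finset.sum_subset hsub, Finset.sum_product]
      · simp only [smoothKernel, endpoints, Fin.prod_univ_four]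
        rw [mul_mul_mul_comm, Finset.sum_mul_sum]
        congr 1
        · ring
        · refine Finset.sum_congr rfl fun e _ => Finset.sum_congr rfl fun e' _ => ?_
          simp
          ring
      · intro t ht htn
        by_contra hne
        rw [← ne_eq, Finset.prod_ne_zero_iff] at hne
        have hc := hK x hxK (endpoints D.pos t) fun i =>
          dist_lt_of_mollifier_ne_zero hη (hne i (Finset.mem_univ _))
        simp only [Finset.mem_product, Finset.mem_filter, Finset.mem_univ, true_and] at ht
        refine htn ?_
        simp only [GeodesicDrawing.crossingTuples, Finset.mem_filter, Finset.mem_univ, true_and]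
        exact ⟨ht.1, ht.2, by simpa [endpoints] using hc⟩
    · rw [Set.indicator_of_mem (show x ∈ _ \ K from ⟨hx, hxK⟩)]
      have hw : ∀ a b, smoothKernel η G D.pos a b ≤ (1 + s) ^ 2 := fun a b =>
        (smoothKernel_le hη G D.pos a b).trans (by
          rw [sq]
          exact mul_le_mul (hs a) (hs b) (smoothDensity_nonneg hη _ _)
            ((smoothDensity_nonneg hη _ _).trans (hs a)))
      refine le_add_of_le_of_nonneg ?_ h0
      calc _ ≤ (1 + s) ^ 2 * (1 + s) ^ 2 :=
            mul_le_mul (hw _ _) (hw _ _) (smoothKernel_nonneg hη _ _ _ _) (by positivity)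
        _ = (1 + s) ^ 4 := by ring
  · rw [crossingIntegrand, Set.indicator_of_notMem hx]
    refine add_nonneg (Set.indicator_nonneg (fun _ _ => by positivity) _) h0

theorem Cr_smoothKernel_le {V : Type*} [Fintype V] [Nonempty V] {G : SimpleGraph V}
    (D : GeodesicDrawing G) {η : ℝ} (hη : 0 < η) {K : Set (Fin 4 → S2)} (hKc : IsCompact K)
    (hK : ∀ x ∈ K, ∀ y : Fin 4 → S2, (∀ i, dist (x i) (y i) < η) →
      Crosses (y 0) (y 1) (y 2) (y 3))
    {s : ℝ} (hs : ∀ x, smoothDensity η D.pos x ≤ 1 + s) :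
    Cr (smoothKernel η G D.pos) ≤
      8 * (D.cr : ℝ) / (Fintype.card V : ℝ) ^ 4 + 2 / (Fintype.card V : ℝ) ^ 2 +
      (1 + s) ^ 4 * (Measure.pi fun _ : Fin 4 => mu).real
        ({x | Crosses (x 0) (x 1) (x 2) (x 3)} \ K) := by
  have hm := measurableSet_crosses.diff hKc.measurableSet
  have i1 : Integrable (({x | Crosses (x 0) (x 1) (x 2) (x 3)} \ K).indicator
      fun _ => (1 + s) ^ 4) (Measure.pi fun _ : Fin 4 => mu) := (integrable_const _).indicator hm
  have i2 : Integrable (fun x : Fin 4 → S2 => (1 / (Fintype.card V : ℝ) ^ 4) *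
        ∑ t ∈ D.crossingTuples, ∏ i, mollifier η (x i) (endpoints D.pos t i))
        (Measure.pi fun _ : Fin 4 => mu) :=
    (integrable_finsetSum _ fun t _ => integrable_prod_mollifier η _).const_mul _
  have hcard : (D.crossingTuples.card : ℝ) ≤ 8 * D.cr + 2 * (Fintype.card V : ℝ) ^ 2 := by
    exact_mod_cast D.card_crossingTuples_le
  have hn : (0 : ℝ) < Fintype.card V := by exact_mod_cast Fintype.card_pos
  calc Cr (smoothKernel η G D.pos) ≤ _ := integral_mono
        (integrable_crossingIntegrand (contMDiff_smoothKernel η G D.pos).continuous)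
        (i1.add i2) (crossingIntegrand_smoothKernel_le D hη hK hs)
    _ = (1 + s) ^ 4 * (Measure.pi fun _ : Fin 4 => mu).real
        ({x | Crosses (x 0) (x 1) (x 2) (x 3)} \ K) +
        1 / (Fintype.card V : ℝ) ^ 4 * D.crossingTuples.card := by
      rw [integral_add' i1 i2, integral_indicator_const _ hm, integral_const_mul,
        integral_finsetSum _ fun t _ => integrable_prod_mollifier η _]
      simp [integral_prod_mollifier hη, mul_comm]
    _ ≤ (1 + s) ^ 4 * (Measure.pi fun _ : Fin 4 => mu).real
        ({x | Crosses (x 0) (x 1) (x 2) (x 3)} \ K) +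
        1 / (Fintype.card V : ℝ) ^ 4 * (8 * D.cr + 2 * (Fintype.card V : ℝ) ^ 2) := by
      gcongr
    _ = _ := by field_simp; ring

/-! ### Conclusion. -/

/-- The uniform distance of the smoothed vertex density to `1`. -/
noncomputable def densityError {V : Type*} [Fintype V] (η : ℝ) (p : V → S2) : ℝ :=
  ‖(⟨smoothDensity η p, continuous_smoothDensity η p⟩ - 1 : C(S2, ℝ))‖

theorem abs_smoothDensity_sub_one_le {V : Type*} [Fintype V] (η : ℝ) (p : V → S2) (x : S2) :
    |smoothDensity η p x - 1| ≤ densityError η p :=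
  ContinuousMap.norm_coe_le_norm
    (⟨smoothDensity η p, continuous_smoothDensity η p⟩ - 1 : C(S2, ℝ)) x

theorem tendsto_densityError {V : ℕ → Type*} [∀ n, Fintype (V n)] {G : ∀ n, SimpleGraph (V n)}
    {D : ∀ n, GeodesicDrawing (G n)} (hD : IsUniform D) {η : ℝ} (hη : 0 < η) :
    Tendsto (fun n => densityError η (D n).pos) atTop (𝓝 0) := by
  refine Metric.tendsto_nhds.2 fun ε hε => ?_
  filter_upwards [eventually_smoothDensity hD hη (half_pos hε)] with n hn
  have h : densityError η (D n).pos ≤ ε / 2 :=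
    (ContinuousMap.norm_le _ (half_pos hε).le).2 hn
  rw [Real.dist_eq, sub_zero, abs_of_nonneg (show 0 ≤ densityError η (D n).pos from norm_nonneg _)]
  linarith

end SphericalDrawing
open SphericalDrawing in
theorem proposition4p3 :
    ∃ c : ℝ, 0 < c ∧ ∃ C : ℝ, 0 < C ∧
      ∀ (V : ℕ → Type*) [∀ n, Fintype (V n)] (G : ∀ n, SimpleGraph (V n))
        (D : ∀ n, GeodesicDrawing (G n)), IsUniform D →
      ∀ δ : ℝ, 0 < δ → δ < c →
      ∃ (ρ : ℕ → S2 → ℝ) (w : ℕ → S2 → S2 → ℝ),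
        -- smoothness and non-negativity
        (∀ n, 0 < n →
          ContMDiff (𝓡 2) 𝓘(ℝ, ℝ) ∞ (ρ n) ∧ (∀ x, 0 ≤ ρ n x) ∧
          ContMDiff ((𝓡 2).prod (𝓡 2)) 𝓘(ℝ, ℝ) ∞ (Function.uncurry (w n)) ∧
          (∀ x y, 0 ≤ w n x y)) ∧
        -- (i)
        (∀ n, 0 < n → ∫ x, ρ n x ∂mu = 1) ∧
        Tendsto (fun n => eLpNorm (fun x => ρ n x - 1) ⊤ mu) atTop (𝓝 0) ∧
        -- (ii)
        (∀ n, 0 < n →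
          (∀ x y, w n x y = w n y x) ∧
          (∀ x y, w n x y ≤ ρ n x * ρ n y) ∧
          edgeDensity (w n) = 2 * ((G n).edgeSet.ncard : ℝ) / (n : ℝ) ^ 2) ∧
        -- (iii)
        ∃ ε : ℕ → ℝ, Tendsto ε atTop (𝓝 0) ∧
          ∀ n, 0 < n → Cr (w n) ≤ 8 * ((D n).cr : ℝ) / (n : ℝ) ^ 4 + C * √δ + ε n := by
  refine ⟨1, one_pos, 1, one_pos, fun V _ G D hD δ hδ _ => ?_⟩
  -- The exceptional mass is taken to be `√δ` itself, so `C = 1` works. The radius `η` depends on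
  -- `δ` alone, which allows `n → ∞` with `η` fixed.
  obtain ⟨K, hKc, hKm, η, hη, hK⟩ := exists_compact_stable (Real.sqrt_pos.2 hδ)
  have hs := tendsto_densityError hD hη
  refine ⟨fun n => smoothDensity η (D n).pos, fun n => smoothKernel η (G n) (D n).pos,
    fun n _ => ⟨contMDiff_smoothDensity _ _, smoothDensity_nonneg hη _,
      contMDiff_smoothKernel _ _ _, smoothKernel_nonneg hη _ _⟩, fun n hn => ?_, ?_,
    fun n _ => ⟨smoothKernel_comm _ _ _, smoothKernel_le hη _ _, ?_⟩,
    -- The first term comes from pairs with the same underlying edge, the second is the excess of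
    -- `(1 + s) ^ 4 * √δ` over `√δ`, where `s` is the density error.
    fun n => 2 / (n : ℝ) ^ 2 + ((1 + densityError η (D n).pos) ^ 4 - 1) * √δ, ?_, fun n hn => ?_⟩
  · have : Nonempty (V n) := Fintype.card_pos_iff.1 ((hD.1 n).symm ▸ hn)
    exact integral_smoothDensity hη _
  · have h0 : Tendsto (fun n => ENNReal.ofReal (densityError η (D n).pos)) atTop (𝓝 0) := by
      simpa using ENNReal.tendsto_ofReal hs
    refine tendsto_of_tendsto_of_tendsto_of_le_of_le tendsto_const_nhds h0 (fun _ => zero_le)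
      fun n => ?_
    rw [eLpNorm_exponent_top]
    exact eLpNormEssSup_le_of_ae_bound
      (Eventually.of_forall fun x => abs_smoothDensity_sub_one_le η (D n).pos x)
  · rw [edgeDensity_smoothKernel hη, hD.1 n]
  · have h1 : Tendsto (fun n : ℕ => 2 / (n : ℝ) ^ 2) atTop (𝓝 0) :=
      tendsto_const_nhds.div_atTop
        ((tendsto_pow_atTop two_ne_zero).comp tendsto_natCast_atTop_atTop)
    simpa using h1.add ((((hs.const_add 1).pow 4).sub_const 1).mul_const √δ)
  · have : Nonempty (V n) := Fintype.card_pos_iff.1 ((hD.1 n).symm ▸ hn)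
    have h := Cr_smoothKernel_le (D n) hη hKc hK (s := densityError η (D n).pos) fun x => by
      linarith [(abs_le.1 (abs_smoothDensity_sub_one_le η (D n).pos x)).2]
    rw [hD.1 n] at h
    have h2 : (1 + densityError η (D n).pos) ^ 4 * (Measure.pi fun _ : Fin 4 => mu).real
        ({x | Crosses (x 0) (x 1) (x 2) (x 3)} \ K) ≤ (1 + densityError η (D n).pos) ^ 4 * √δ := by
      gcongr
    linarith
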